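/- An \emph{mpM-algebra} (modal pseudocomplemented De Morgan algebra) is a bounded distributive lattice $A$ with two unary operations $\sim$ and ${}^{*}$ such that, for all $a,x,y\in A$: $\sim\sim x=x$; $\sim(x\vee y)=\sim x\,\wedge\sim y$; $a\wedge x=0$ if and only if $x\le a^{*}$; and $x\,\vee\sim x\le x\vee x^{*}$. Let $k\ge 1$. A \emph{$\mathcal C_k$-algebra} is a pair $(A,t)$ where $A$ is an mpM-algebra and $t:A\to A$ is an automorphism of $A$ with $t^k(x)=x$ for all $x$; homomorphisms preserve $\wedge,\vee,\sim,{}^{*},0,1$ and $t$. For a positive integer $d$ let $M(d)$ be the set of divisors of $d$ different from $d$ that are maximal (for divisibility) among the divisors of $d$ different from $d$. For $H\subseteq M(d)\times M(d)$ let $H_1$ and $H_2$ be its projections to the first and the second coordinate. \textbf{Theorem.} Let $F_{\mathcal C_k}(n)$ be the free $\mathcal C_k$-algebra with $n$ generators. Then $F_{\mathcal C_k}(n)$ is finite and $$|F_{\mathcal C_k}(n)|=\prod_{d\mid k}(2^{d})^{\alpha_{2,d}}\cdot\prod_{d\mid k}(3^{d})^{\alpha_{3,d}}\cdot\prod_{d\mid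 k}(4^{d})^{\alpha_{4,d}},$$ where the exponents are the rational numbers $$\alpha_{2,d}=\frac{(2^d)^n-\sum_{\emptyset\ne Z\subseteq M(d)}(-1)^{|Z|-1}(2^{\gcd(Z)})^n}{d},$$ $$\alpha_{3,d}=\frac{(3^d)^n-(2^d)^n-\sum_{\emptyset\ne W\subseteq M(d)}(-1)^{|W|-1}(3^{\gcd(W)})^n+\sum_{\emptyset\ne H\subseteq M(d)\times M(d)}(-1)^{|H|-1}(2^{\gcd(H_1\cup H_2)})^n}{d},$$ $$\alpha_{4,d}=\frac{(4^d)^n-\sum_{\emptyset\ne W\subseteq M(d)}(-1)^{|W|-1}(4^{\gcd(W)})^n-(2^d)^n+\sum_{\emptyset\ne H\subseteq M(d)\times M(d)}(-1)^{|H|-1}(2^{\gcd(H_1\cup H_2)})^n}{2d}.$$ -/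

import Mathlib

/-- A modal pseudocomplemented De Morgan algebra (mpM-algebra): a bounded distributive lattice
with a De Morgan negation `dm` (written `∼`) and a pseudocomplement `pc` (written `*`) such that
`x ⊔ ∼x ≤ x ⊔ x*`. -/
class MpMAlgebra (A : Type*) extends DistribLattice A, BoundedOrder A where
  /-- the De Morgan negation `∼` -/
  dm : A → A
  /-- the pseudocomplement `*` -/
  pc : A → A
  dm_dm : ∀ x : A, dm (dm x) = x
  dm_sup : ∀ x y : A, dm (x ⊔ y) = dm x ⊓ dm y
  inf_eq_bot_iff : ∀ a x : A, a ⊓ x = ⊥ ↔ x ≤ pc a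
  tm : ∀ x : A, x ⊔ dm x ≤ x ⊔ pc x

/-- `f` is a homomorphism of mpM-algebras. -/
structure IsMpMHom {A B : Type*} [MpMAlgebra A] [MpMAlgebra B] (f : A → B) : Prop where
  map_bot : f ⊥ = ⊥
  map_top : f ⊤ = ⊤
  map_inf : ∀ x y, f (x ⊓ y) = f x ⊓ f y
  map_sup : ∀ x y, f (x ⊔ y) = f x ⊔ f y
  map_dm : ∀ x, f (MpMAlgebra.dm x) = MpMAlgebra.dm (f x)
  map_pc : ∀ x, f (MpMAlgebra.pc x) = MpMAlgebra.pc (f x)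

/-- A `k`-cyclic mpM-algebra (`C_k`-algebra): an mpM-algebra with an automorphism `t` such that
`t^k` is the identity. -/
class CkAlgebra (k : ℕ) (A : Type*) extends MpMAlgebra A where
  /-- the automorphism -/
  t : A → A
  t_hom : IsMpMHom t
  t_bijective : Function.Bijective t
  t_iterate : ∀ x : A, t^[k] x = x

/-- `f` is a homomorphism of `C_k`-algebras. -/
structure IsCkHom (k : ℕ) {A B : Type*} [CkAlgebra k A] [CkAlgebra k B] (f : A → B) : Prop
    extends IsMpMHom f where
  map_t : ∀ x, f (CkAlgebra.t k x) = CkAlgebra.t k (f x)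

/-- Terms in the language of `C_k`-algebras with variables from `X`. -/
inductive CkTerm (X : Type*) where
  | var : X → CkTerm X
  | bot : CkTerm X
  | top : CkTerm X
  | inf : CkTerm X → CkTerm X → CkTerm X
  | sup : CkTerm X → CkTerm X → CkTerm X
  | dm : CkTerm X → CkTerm X
  | pc : CkTerm X → CkTerm X
  | t : CkTerm X → CkTerm X

namespace CkTerm

/-- The least congruence on terms whose quotient satisfies the laws of `C_k`-algebras
(`x ≤ y` is expressed as `x ⊓ y = x`). -/
inductive Eqv (k : ℕ) {X : Type*} : CkTerm X → CkTerm X → Prop where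
  | refl (x) : Eqv k x x
  | symm {x y} : Eqv k x y → Eqv k y x
  | trans {x y z} : Eqv k x y → Eqv k y z → Eqv k x z
  | congr_inf {x x' y y'} : Eqv k x x' → Eqv k y y' → Eqv k (inf x y) (inf x' y')
  | congr_sup {x x' y y'} : Eqv k x x' → Eqv k y y' → Eqv k (sup x y) (sup x' y')
  | congr_dm {x x'} : Eqv k x x' → Eqv k (dm x) (dm x')
  | congr_pc {x x'} : Eqv k x x' → Eqv k (pc x) (pc x')
  | congr_t {x x'} : Eqv k x x' → Eqv k (t x) (t x')
  | inf_comm (x y) : Eqv k (inf x y) (inf y x)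
  | inf_assoc (x y z) : Eqv k (inf (inf x y) z) (inf x (inf y z))
  | sup_comm (x y) : Eqv k (sup x y) (sup y x)
  | sup_assoc (x y z) : Eqv k (sup (sup x y) z) (sup x (sup y z))
  | sup_inf_self (x y) : Eqv k (sup x (inf x y)) x
  | inf_sup_self (x y) : Eqv k (inf x (sup x y)) x
  | distrib (x y z) : Eqv k (inf (sup x y) (sup x z)) (sup x (inf y z))
  | bot_inf (x) : Eqv k (inf bot x) bot
  | inf_top (x) : Eqv k (inf x top) x
  | dm_dm (x) : Eqv k (dm (dm x)) x
  | dm_sup (x y) : Eqv k (dm (sup x y)) (inf (dm x) (dm y))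
  | le_pc {a x} : Eqv k (inf a x) bot → Eqv k (inf x (pc a)) x
  | inf_pc {a x} : Eqv k (inf x (pc a)) x → Eqv k (inf a x) bot
  | tm (x) : Eqv k (inf (sup x (dm x)) (sup x (pc x))) (sup x (dm x))
  | t_bot : Eqv k (t bot) bot
  | t_top : Eqv k (t top) top
  | t_inf (x y) : Eqv k (t (inf x y)) (inf (t x) (t y))
  | t_sup (x y) : Eqv k (t (sup x y)) (sup (t x) (t y))
  | t_dm (x) : Eqv k (t (dm x)) (dm (t x))
  | t_pc (x) : Eqv k (t (pc x)) (pc (t x))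
  | t_iterate (x) : Eqv k (t^[k] x) x

/-- The congruence `Eqv` as a setoid. -/
def eqvSetoid (k : ℕ) (X : Type*) : Setoid (CkTerm X) :=
  ⟨Eqv k, Eqv.refl, Eqv.symm, Eqv.trans⟩

/-- The value of a term in a `C_k`-algebra. -/
def eval (k : ℕ) {X A : Type*} [CkAlgebra k A] (v : X → A) : CkTerm X → A
  | var i => v i
  | bot => ⊥
  | top => ⊤
  | inf x y => eval k v x ⊓ eval k v y
  | sup x y => eval k v x ⊔ eval k v y
  | dm x => MpMAlgebra.dm (eval k v x)
  | pc x => MpMAlgebra.pc (eval k v x)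
  | t x => CkAlgebra.t k (eval k v x)

theorem eval_iterate (k : ℕ) {X A : Type*} [CkAlgebra k A] (v : X → A) (m : ℕ) (x : CkTerm X) :
    eval k v (t^[m] x) = (CkAlgebra.t k)^[m] (eval k v x) := by
  induction m generalizing x with
  | zero => rfl
  | succ m ih => rw [Function.iterate_succ_apply, Function.iterate_succ_apply, ih]; rfl

theorem eval_eq_of_eqv (k : ℕ) {X A : Type*} [CkAlgebra k A] (v : X → A) {x y : CkTerm X}
    (h : Eqv k x y) : eval k v x = eval k v y := by
  have ht : IsMpMHom (CkAlgebra.t k : A → A) := CkAlgebra.t_hom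
  induction h with
  | refl x => rfl
  | symm _ ih => exact ih.symm
  | trans _ _ ih1 ih2 => exact ih1.trans ih2
  | congr_inf _ _ ih1 ih2 => simp only [eval, ih1, ih2]
  | congr_sup _ _ ih1 ih2 => simp only [eval, ih1, ih2]
  | congr_dm _ ih => simp only [eval, ih]
  | congr_pc _ ih => simp only [eval, ih]
  | congr_t _ ih => simp only [eval, ih]
  | inf_comm x y => exact _root_.inf_comm _ _
  | inf_assoc x y z => exact _root_.inf_assoc _ _ _
  | sup_comm x y => exact _root_.sup_comm _ _
  | sup_assoc x y z => exact _root_.sup_assoc _ _ _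
  | sup_inf_self x y => exact _root_.sup_inf_self
  | inf_sup_self x y => exact _root_.inf_sup_self
  | distrib x y z => exact (sup_inf_left _ _ _).symm
  | bot_inf x => exact bot_inf_eq _
  | inf_top x => exact inf_top_eq _
  | dm_dm x => exact MpMAlgebra.dm_dm _
  | dm_sup x y => exact MpMAlgebra.dm_sup _ _
  | le_pc _ ih => exact inf_eq_left.2 ((MpMAlgebra.inf_eq_bot_iff _ _).1 ih)
  | inf_pc _ ih => exact (MpMAlgebra.inf_eq_bot_iff _ _).2 (inf_eq_left.1 ih)
  | tm x => exact inf_eq_left.2 (MpMAlgebra.tm _)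
  | t_bot => exact ht.map_bot
  | t_top => exact ht.map_top
  | t_inf x y => exact ht.map_inf _ _
  | t_sup x y => exact ht.map_sup _ _
  | t_dm x => exact ht.map_dm _
  | t_pc x => exact ht.map_pc _
  | t_iterate x => rw [eval_iterate]; exact CkAlgebra.t_iterate _

end CkTerm

/-- The free `C_k`-algebra `F_{C_k}(X)` on the set `X` of generators. -/
def FreeCk (k : ℕ) (X : Type*) : Type _ := Quotient (CkTerm.eqvSetoid k X)

namespace FreeCk

variable {k : ℕ} {X : Type*}

/-- The class of a term. -/
def mk (x : CkTerm X) : FreeCk k X := Quotient.mk (CkTerm.eqvSetoid k X) x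

/-- The generators. -/
def of (i : X) : FreeCk k X := mk (CkTerm.var i)

theorem mk_eq {x y : CkTerm X} : (mk x : FreeCk k X) = mk y ↔ CkTerm.Eqv k x y :=
  ⟨fun h => Quotient.exact h, fun h => Quotient.sound h⟩

theorem ind {p : FreeCk k X → Prop} (h : ∀ x, p (mk x)) (x : FreeCk k X) : p x :=
  Quotient.ind h x

instance instMax : Max (FreeCk k X) :=
  ⟨Quotient.map₂ CkTerm.sup fun _ _ h _ _ h' => CkTerm.Eqv.congr_sup h h'⟩

instance instMin : Min (FreeCk k X) :=
  ⟨Quotient.map₂ CkTerm.inf fun _ _ h _ _ h' => CkTerm.Eqv.congr_inf h h'⟩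

/-- The lattice order on the free algebra is `x ≤ y ↔ x ⊔ y = y`. -/
instance instLattice : Lattice (FreeCk k X) :=
  Lattice.mk'
    (ind fun x => ind fun y => mk_eq.2 (.sup_comm x y))
    (ind fun x => ind fun y => ind fun z => mk_eq.2 (.sup_assoc x y z))
    (ind fun x => ind fun y => mk_eq.2 (.inf_comm x y))
    (ind fun x => ind fun y => ind fun z => mk_eq.2 (.inf_assoc x y z))
    (ind fun x => ind fun y => mk_eq.2 (.sup_inf_self x y))
    (ind fun x => ind fun y => mk_eq.2 (.inf_sup_self x y))

theorem mk_le {x y : CkTerm X} :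
    (mk x : FreeCk k X) ≤ mk y ↔ CkTerm.Eqv k (CkTerm.inf x y) x := by
  rw [← inf_eq_left]
  exact mk_eq

instance instDistribLattice : DistribLattice (FreeCk k X) where
  le_sup_inf := ind fun x => ind fun y => ind fun z => by
    have h : ((mk x ⊔ mk y) ⊓ (mk x ⊔ mk z) : FreeCk k X) = mk x ⊔ (mk y ⊓ mk z) :=
      mk_eq.2 (.distrib x y z)
    exact h.le

instance instBoundedOrder : BoundedOrder (FreeCk k X) where
  bot := mk .bot
  top := mk .top
  bot_le := ind fun x => mk_le.2 (.bot_inf x)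
  le_top := ind fun x => mk_le.2 (.inf_top x)

instance instMpMAlgebra : MpMAlgebra (FreeCk k X) where
  dm := Quotient.map CkTerm.dm fun _ _ h => CkTerm.Eqv.congr_dm h
  pc := Quotient.map CkTerm.pc fun _ _ h => CkTerm.Eqv.congr_pc h
  dm_dm := ind fun x => mk_eq.2 (.dm_dm x)
  dm_sup := ind fun x => ind fun y => mk_eq.2 (.dm_sup x y)
  inf_eq_bot_iff := ind fun _ => ind fun _ =>
    ⟨fun h => mk_le.2 (.le_pc (mk_eq.1 h)), fun h => mk_eq.2 (.inf_pc (mk_le.1 h))⟩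
  tm := ind fun x => mk_le.2 (.tm x)

/-- The operation `t` of the free algebra. -/
def tMap : FreeCk k X → FreeCk k X := Quotient.map CkTerm.t fun _ _ h => CkTerm.Eqv.congr_t h

theorem tMap_iterate_mk (m : ℕ) (x : CkTerm X) :
    (tMap : FreeCk k X → FreeCk k X)^[m] (mk x) = mk (CkTerm.t^[m] x) := by
  induction m generalizing x with
  | zero => rfl
  | succ m ih => rw [Function.iterate_succ_apply, Function.iterate_succ_apply, ← ih]; rfl

theorem tMap_iterate (x : FreeCk k X) : tMap^[k] x = x :=
  ind (p := fun x => tMap^[k] x = x)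
    (fun x => (tMap_iterate_mk k x).trans (mk_eq.2 (.t_iterate x))) x

instance instCkAlgebra [NeZero k] : CkAlgebra k (FreeCk k X) where
  t := tMap
  t_hom :=
    { map_bot := mk_eq.2 .t_bot
      map_top := mk_eq.2 .t_top
      map_inf := ind fun x => ind fun y => mk_eq.2 (.t_inf x y)
      map_sup := ind fun x => ind fun y => mk_eq.2 (.t_sup x y)
      map_dm := ind fun x => mk_eq.2 (.t_dm x)
      map_pc := ind fun x => mk_eq.2 (.t_pc x) }
  t_bijective := by
    obtain ⟨m, hm⟩ := Nat.exists_eq_succ_of_ne_zero (NeZero.ne k)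
    have key : ∀ x : FreeCk k X, tMap^[m.succ] x = x := fun x => by
      simpa only [← hm] using tMap_iterate x
    exact ⟨Function.LeftInverse.injective (g := tMap^[m]) fun x =>
        (Function.iterate_succ_apply tMap m x).symm.trans (key x),
      Function.RightInverse.surjective (g := tMap^[m]) fun x =>
        (Function.iterate_succ_apply' tMap m x).symm.trans (key x)⟩
  t_iterate := tMap_iterate

/-- The universal property of the free `C_k`-algebra: every map from the generators into a
`C_k`-algebra extends to exactly one homomorphism. -/
theorem existsUnique_lift [NeZero k] {A : Type*} [CkAlgebra k A] (v : X → A) :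
    ∃! f : FreeCk k X → A, IsCkHom k f ∧ ∀ i, f (of i) = v i := by
  refine ⟨Quotient.lift (CkTerm.eval k v) fun _ _ h => CkTerm.eval_eq_of_eqv k v h,
    ⟨⟨⟨rfl, rfl, ind fun _ => ind fun _ => rfl, ind fun _ => ind fun _ => rfl,
      ind fun _ => rfl, ind fun _ => rfl⟩, ind fun _ => rfl⟩, fun _ => rfl⟩, ?_⟩
  rintro f ⟨hf, hv⟩
  funext x
  refine ind (p := fun x => f x = _) (fun x => ?_) x
  change f (mk x) = CkTerm.eval k v x
  induction x with
  | var i => exact hv i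
  | bot => exact hf.map_bot
  | top => exact hf.map_top
  | inf x y hx hy => exact (hf.map_inf (mk x) (mk y)).trans (by rw [hx, hy]; rfl)
  | sup x y hx hy => exact (hf.map_sup (mk x) (mk y)).trans (by rw [hx, hy]; rfl)
  | dm x hx => exact (hf.map_dm (mk x)).trans (by rw [hx]; rfl)
  | pc x hx => exact (hf.map_pc (mk x)).trans (by rw [hx]; rfl)
  | t x hx => exact (hf.map_t (mk x)).trans (by rw [hx]; rfl)

end FreeCk

/-- `M(d)`: the divisors of `d` different from `d` that are maximal, with respect to
divisibility, among the divisors of `d` different from `d`. -/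
def maxDivisors (d : ℕ) : Finset ℕ :=
  d.properDivisors.filter fun x => ∀ y ∈ d.properDivisors, x ∣ y → x = y

/-- `∑ (-1)^(|Z|-1) (c^gcd(Z))^n` over the nonempty `Z ⊆ M(d)`. -/
def sumOver (c n d : ℕ) : ℚ :=
  ∑ Z ∈ (maxDivisors d).powerset with Z.Nonempty,
    (-1 : ℚ) ^ (Z.card - 1) * ((c : ℚ) ^ (Z.gcd id)) ^ n

/-- `∑ (-1)^(|H|-1) (2^gcd(H₁ ∪ H₂))^n` over the nonempty `H ⊆ M(d) × M(d)`, where `H₁` and `H₂`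
are the two projections of `H`. -/
def sumOverPairs (n d : ℕ) : ℚ :=
  ∑ H ∈ (maxDivisors d ×ˢ maxDivisors d).powerset with H.Nonempty,
    (-1 : ℚ) ^ (H.card - 1) *
      ((2 : ℚ) ^ ((H.image Prod.fst ∪ H.image Prod.snd).gcd id)) ^ n

/-- The exponent `α_{2,d}`. -/
def alpha2 (n d : ℕ) : ℚ := ((2 ^ d) ^ n - sumOver 2 n d) / d

/-- The exponent `α_{3,d}`. -/
def alpha3 (n d : ℕ) : ℚ :=
  ((3 ^ d) ^ n - (2 ^ d) ^ n - sumOver 3 n d + sumOverPairs n d) / d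

/-- The exponent `α_{4,d}`; it need not be an integer. -/
def alpha4 (n d : ℕ) : ℚ :=
  ((4 ^ d) ^ n - sumOver 4 n d - (2 ^ d) ^ n + sumOverPairs n d) / (2 * d)

/-! Both sides equal `2 ^ (4 ^ (k * n)) * 3 ^ (3 ^ (k * n) - 2 ^ (k * n))`.

Algebra: forget `t`. By the universal property applied to the shift algebra `ZMod k → B`, the
mpM-reduct of the free algebra is free on the `k * n` elements `t^m(x_i)`, so it has `(|B| ^ k) ^ n`
homomorphisms into any mpM-algebra `B` (`homEquiv`, `card_hom`). In an mpM-algebra a prime filter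
`P` is comparable only with itself and with its dual `{a | ∼a ∉ P}` (`eq_or_eq_dual_of_le`). Filters
that equal, or are incomparable with, their dual correspond to homomorphisms into the four-element
algebra. Two-element chains `P ⊂ dual P` correspond to homomorphisms into the three-element chain
that take the value `1`. If there are finitely many homomorphisms of these kinds, the algebra is the
lattice of upper sets of a disjoint union of points and two-element chains: each point contributes a
factor 2 and each chain a factor 3 (`card_eq`). There are `4 ^ (k * n)` points and `3 ^ (k * n) - 2
^ (k * n)` chains, the subtracted term counting the two-valued homomorphisms.

Arithmetic: write `(c ^ m) ^ n` as a divisor sum of some `h` by Möbius inversion. The alternating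
sums in the exponents are inclusion-exclusion over the maximal proper divisors, so they remove all
of the divisor sum except `h d`. Hence the sum of `d * α_d` over `d ∣ k` is again a divisor sum and
collapses to powers with exponent `k * n`. -/

/-! ### Arithmetic of the exponents: inclusion-exclusion over maximal proper divisors. -/

theorem exists_sum_divisors_eq (g : ℕ → ℚ) :
    ∃ h : ℕ → ℚ, ∀ m > 0, ∑ e ∈ m.divisors, h e = g m :=
  ⟨fun m => ∑ x ∈ m.divisorsAntidiagonal, (ArithmeticFunction.moebius x.1 : ℚ) * g x.2,
    ArithmeticFunction.sum_eq_iff_sum_mul_moebius_eq.2 fun _ _ => rfl⟩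

theorem sum_nonempty_powerset_neg_one_pow {ι : Type*} [DecidableEq ι] (I : Finset ι) :
    ∑ Z ∈ I.powerset with Z.Nonempty, (-1 : ℚ) ^ (Z.card - 1) = if I.Nonempty then 1 else 0 := by
  have h1 : ∑ Z ∈ I.powerset with Z.Nonempty, (-1 : ℚ) ^ (Z.card - 1) =
      -∑ Z ∈ I.powerset with Z.Nonempty, (-1 : ℚ) ^ Z.card := by
    rw [← Finset.sum_neg_distrib]
    refine Finset.sum_congr rfl fun Z hZ => ?_
    have hc : 0 < Z.card := (Finset.mem_filter.1 hZ).2.card_pos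
    obtain ⟨c, hc'⟩ : ∃ c, Z.card = c + 1 := ⟨Z.card - 1, by omega⟩
    rw [hc', pow_succ]
    simp
  have h2 : I.powerset.filter (fun Z => ¬ Z.Nonempty) = {∅} := by
    ext Z
    simp only [Finset.mem_filter, Finset.mem_powerset, Finset.not_nonempty_iff_eq_empty,
      Finset.mem_singleton]
    exact ⟨fun h => h.2, fun h => ⟨by simp [h], h⟩⟩
  have h3 := Finset.sum_filter_add_sum_filter_not I.powerset (fun Z => Z.Nonempty)
    (fun Z => (-1 : ℚ) ^ Z.card)
  have h4 : ∑ Z ∈ I.powerset, (-1 : ℚ) ^ Z.card = if I = ∅ then 1 else 0 := by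
    have := Finset.sum_powerset_neg_one_pow_card (x := I)
    exact_mod_cast this
  rw [h2, h4] at h3
  rw [h1]
  simp only [Finset.sum_singleton, Finset.card_empty, pow_zero] at h3
  by_cases hI : I = ∅
  · simp only [hI, if_true, Finset.not_nonempty_empty, if_false] at h3 ⊢
    linarith
  · simp only [hI, if_false, Finset.nonempty_iff_ne_empty, ne_eq, not_false_eq_true, if_true]
      at h3 ⊢
    linarith

/-- Inclusion-exclusion over a finite family of proper divisors `D i` of `d` that together lie
above every proper divisor of `d`; `γ Z` is the greatest common divisor of the `D i`, `i ∈ Z`. -/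
theorem sum_nonempty_powerset_gcd {ι : Type*} [DecidableEq ι] {g h : ℕ → ℚ}
    (hgh : ∀ m > 0, ∑ e ∈ m.divisors, h e = g m) {d : ℕ} (hd : 0 < d) (I : Finset ι)
    (D : ι → ℕ) (γ : Finset ι → ℕ) (hγ : ∀ Z e, e ∣ γ Z ↔ ∀ i ∈ Z, e ∣ D i)
    (hD : ∀ i ∈ I, D i ∣ d) (hI : ∀ e ∈ d.divisors, (∃ i ∈ I, e ∣ D i) ↔ e ≠ d) :
    ∑ Z ∈ I.powerset with Z.Nonempty, (-1 : ℚ) ^ (Z.card - 1) * g (γ Z) = g d - h d := by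
  have h1 : ∀ Z ∈ I.powerset.filter (fun Z => Z.Nonempty),
      (-1 : ℚ) ^ (Z.card - 1) * g (γ Z) =
        ∑ e ∈ d.divisors, if e ∣ γ Z then (-1 : ℚ) ^ (Z.card - 1) * h e else 0 := by
    intro Z hZ
    obtain ⟨hZI, i, hi⟩ := Finset.mem_filter.1 hZ
    have hdvd : γ Z ∣ d :=
      ((hγ Z (γ Z)).1 dvd_rfl i hi).trans (hD i (Finset.mem_powerset.1 hZI hi))
    rw [← hgh _ (Nat.pos_of_dvd_of_pos hdvd hd), Finset.mul_sum, ← Finset.sum_filter,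
      Nat.divisors_filter_dvd_of_dvd hd.ne' hdvd]
  -- After the exchange, `h e` is multiplied by the alternating sum over the nonempty subsets of `{i
  -- ∈ I | e ∣ D i}`. This is 1 when that set is nonempty, that is for `e ≠ d`, and 0 for `e = d`.
  rw [Finset.sum_congr rfl h1, Finset.sum_comm]
  have h2 : ∀ e ∈ d.divisors,
      (∑ Z ∈ I.powerset with Z.Nonempty, if e ∣ γ Z then (-1 : ℚ) ^ (Z.card - 1) * h e else 0) =
        if e = d then 0 else h e := by
    intro e he
    have h3 : (I.powerset.filter (fun Z => Z.Nonempty)).filter (fun Z => e ∣ γ Z) =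
        (I.filter (fun i => e ∣ D i)).powerset.filter (fun Z => Z.Nonempty) := by
      ext Z
      simp only [Finset.mem_filter, Finset.mem_powerset, hγ, Finset.subset_iff]
      grind
    rw [← Finset.sum_filter, h3, ← Finset.sum_mul, sum_nonempty_powerset_neg_one_pow]
    have h4 : (I.filter (fun i => e ∣ D i)).Nonempty ↔ e ≠ d := by
      rw [← hI e he, Finset.filter_nonempty_iff]
    rw [if_congr h4 rfl rfl]
    by_cases hed : e = d <;> simp [hed]
  rw [Finset.sum_congr rfl h2, ← hgh d hd,
    ← Finset.add_sum_erase _ h (Nat.mem_divisors_self d hd.ne'),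
    ← Finset.add_sum_erase _ _ (Nat.mem_divisors_self d hd.ne'), if_pos rfl, zero_add,
    add_sub_cancel_left]
  exact Finset.sum_congr rfl fun e he => if_neg (Finset.mem_erase.1 he).1

theorem exists_mem_maxDivisors_dvd_iff {d e : ℕ} (he : e ∈ d.divisors) :
    (∃ m ∈ maxDivisors d, e ∣ m) ↔ e ≠ d := by
  obtain ⟨hed, hd⟩ := Nat.mem_divisors.1 he
  constructor
  · rintro ⟨m, hm, hem⟩ rfl
    have hm' := Nat.mem_properDivisors.1 (Finset.mem_filter.1 hm).1
    exact absurd (Nat.le_of_dvd (Nat.pos_of_dvd_of_pos hm'.1 (Nat.pos_of_ne_zero hd)) hem)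
      (by omega)
  · intro hne
    have hmem : e ∈ d.properDivisors.filter (e ∣ ·) :=
      Finset.mem_filter.2 ⟨Nat.mem_properDivisors.2
        ⟨hed, lt_of_le_of_ne (Nat.le_of_dvd (Nat.pos_of_ne_zero hd) hed) hne⟩, dvd_rfl⟩
    obtain ⟨m, hm, hmax⟩ := Finset.exists_max_image _ id ⟨e, hmem⟩
    obtain ⟨hmd, hem⟩ := Finset.mem_filter.1 hm
    refine ⟨m, Finset.mem_filter.2 ⟨hmd, fun y hy hmy => ?_⟩, hem⟩
    have h1 : y ≤ m := hmax y (Finset.mem_filter.2 ⟨hy, hem.trans hmy⟩)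
    have h2 := (Nat.mem_properDivisors.1 hy).1
    exact le_antisymm (Nat.le_of_dvd (Nat.pos_of_dvd_of_pos h2 (Nat.pos_of_ne_zero hd)) hmy) h1

theorem dvd_of_mem_maxDivisors {d m : ℕ} (hm : m ∈ maxDivisors d) : m ∣ d :=
  (Nat.mem_properDivisors.1 (Finset.mem_filter.1 hm).1).1

theorem sumOver_eq {c n : ℕ} {h : ℕ → ℚ}
    (hgh : ∀ m > 0, ∑ e ∈ m.divisors, h e = ((c : ℚ) ^ m) ^ n) {d : ℕ} (hd : 0 < d) :
    sumOver c n d = ((c : ℚ) ^ d) ^ n - h d :=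
  sum_nonempty_powerset_gcd hgh hd (maxDivisors d) id (fun Z => Z.gcd id)
    (fun _ _ => Finset.dvd_gcd_iff) (fun _ => dvd_of_mem_maxDivisors)
    (fun _ => exists_mem_maxDivisors_dvd_iff)

/-- A number divides `gcd(H₁ ∪ H₂)` iff it divides `gcd(p.1, p.2)` for every `p ∈ H`. The numbers
`gcd(p.1, p.2)` lie above the same divisors as `M(d)` does, by the diagonal pairs. So the sum over
pairs has the value of the sum over subsets of `M(d)` for `c = 2`. -/
theorem sumOverPairs_eq {n : ℕ} {h : ℕ → ℚ}
    (hgh : ∀ m > 0, ∑ e ∈ m.divisors, h e = ((2 : ℚ) ^ m) ^ n) {d : ℕ} (hd : 0 < d) :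
    sumOverPairs n d = ((2 : ℚ) ^ d) ^ n - h d := by
  refine sum_nonempty_powerset_gcd hgh hd (maxDivisors d ×ˢ maxDivisors d)
    (fun p => Nat.gcd p.1 p.2)
    (fun H => (H.image Prod.fst ∪ H.image Prod.snd).gcd id) (fun H e => ?_)
    (fun p hp => (Nat.gcd_dvd_left _ _).trans
      (dvd_of_mem_maxDivisors (Finset.mem_product.1 hp).1)) (fun e he => ?_)
  · simp only [Finset.dvd_gcd_iff, Finset.mem_union, Finset.mem_image, id, Nat.dvd_gcd_iff]
    grind
  · rw [← exists_mem_maxDivisors_dvd_iff he]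
    constructor
    · rintro ⟨p, hp, hep⟩
      exact ⟨p.1, (Finset.mem_product.1 hp).1, (Nat.dvd_gcd_iff.1 hep).1⟩
    · rintro ⟨m, hm, hem⟩
      exact ⟨(m, m), Finset.mem_product.2 ⟨hm, hm⟩, Nat.dvd_gcd hem hem⟩

theorem sum_mul_alpha2 (n : ℕ) {k : ℕ} (hk : 0 < k) :
    ∑ d ∈ k.divisors, (d : ℚ) * alpha2 n d = (2 ^ k) ^ n := by
  obtain ⟨h2, hh2⟩ := exists_sum_divisors_eq (fun m => (((2 : ℕ) : ℚ) ^ m) ^ n)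
  have key : ∀ d ∈ k.divisors, (d : ℚ) * alpha2 n d = h2 d := by
    intro d hd
    have hd0 : 0 < d := Nat.pos_of_mem_divisors hd
    have : (d : ℚ) ≠ 0 := by positivity
    rw [alpha2, sumOver_eq hh2 hd0]
    push_cast
    field_simp
    ring
  rw [Finset.sum_congr rfl key, hh2 k hk]
  norm_num

theorem sum_mul_alpha3 (n : ℕ) {k : ℕ} (hk : 0 < k) :
    ∑ d ∈ k.divisors, (d : ℚ) * alpha3 n d = (3 ^ k) ^ n - (2 ^ k) ^ n := by
  obtain ⟨h2, hh2⟩ := exists_sum_divisors_eq (fun m => ((2 : ℚ) ^ m) ^ n)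
  obtain ⟨h3, hh3⟩ := exists_sum_divisors_eq (fun m => (((3 : ℕ) : ℚ) ^ m) ^ n)
  have key : ∀ d ∈ k.divisors, (d : ℚ) * alpha3 n d = h3 d - h2 d := by
    intro d hd
    have hd0 : 0 < d := Nat.pos_of_mem_divisors hd
    have : (d : ℚ) ≠ 0 := by positivity
    rw [alpha3, sumOver_eq hh3 hd0, sumOverPairs_eq hh2 hd0]
    push_cast
    field_simp
    ring
  rw [Finset.sum_congr rfl key, Finset.sum_sub_distrib, hh2 k hk, hh3 k hk]
  norm_num

theorem sum_mul_alpha4 (n : ℕ) {k : ℕ} (hk : 0 < k) :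
    ∑ d ∈ k.divisors, (d : ℚ) * alpha4 n d = ((4 ^ k) ^ n - (2 ^ k) ^ n) / 2 := by
  obtain ⟨h2, hh2⟩ := exists_sum_divisors_eq (fun m => ((2 : ℚ) ^ m) ^ n)
  obtain ⟨h4, hh4⟩ := exists_sum_divisors_eq (fun m => (((4 : ℕ) : ℚ) ^ m) ^ n)
  have key : ∀ d ∈ k.divisors, (d : ℚ) * alpha4 n d = (h4 d - h2 d) / 2 := by
    intro d hd
    have hd0 : 0 < d := Nat.pos_of_mem_divisors hd
    have : (d : ℚ) ≠ 0 := by positivity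
    rw [alpha4, sumOver_eq hh4 hd0, sumOverPairs_eq hh2 hd0]
    push_cast
    field_simp
    ring
  rw [Finset.sum_congr rfl key, ← Finset.sum_div, Finset.sum_sub_distrib, hh2 k hk, hh4 k hk]
  norm_num

/-- With real powers only the total `∑ d * α d` matters, so the single exponents need not be
integers. -/
theorem prod_rpow_mul_eq {s : Finset ℕ} {α : ℕ → ℚ} {b : ℝ} (hb : 0 < b) {q : ℚ}
    (h : ∑ d ∈ s, (d : ℚ) * α d = q) :
    ∏ d ∈ s, (b ^ d) ^ (α d : ℝ) = b ^ (q : ℝ) := by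
  rw [← h, Rat.cast_sum, Real.rpow_sum_of_pos hb]
  refine Finset.prod_congr rfl fun d _ => ?_
  rw [Rat.cast_mul, Rat.cast_natCast, Real.rpow_mul hb.le, Real.rpow_natCast]

/-! ### Prime filters: separation of elements and interpolation on finite families. -/

/-- A prime filter of a bounded lattice, as a predicate. -/
structure IsPrimeFilter {L : Type*} [Lattice L] [BoundedOrder L] (P : L → Prop) : Prop where
  top_mem : P ⊤
  bot_notMem : ¬ P ⊥
  inf_mem : ∀ x y, P (x ⊓ y) ↔ P x ∧ P y
  sup_mem : ∀ x y, P (x ⊔ y) ↔ P x ∨ P y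

namespace IsPrimeFilter

theorem mono {L : Type*} [Lattice L] [BoundedOrder L] {P : L → Prop} (hP : IsPrimeFilter P)
    {x y : L} (h : x ≤ y) (hx : P x) : P y :=
  ((hP.inf_mem x y).1 (by rwa [inf_eq_left.2 h])).2

theorem finset_inf_mem {L ι : Type*} [Lattice L] [BoundedOrder L] {P : L → Prop}
    (hP : IsPrimeFilter P) (s : Finset ι) (f : ι → L) : P (s.inf f) ↔ ∀ i ∈ s, P (f i) := by
  classical
  induction s using Finset.induction_on with
  | empty => simp [hP.top_mem]
  | insert i s _ ih => simp [hP.inf_mem, ih]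

theorem finset_sup_mem {L ι : Type*} [Lattice L] [BoundedOrder L] {P : L → Prop}
    (hP : IsPrimeFilter P) (s : Finset ι) (f : ι → L) : P (s.sup f) ↔ ∃ i ∈ s, P (f i) := by
  classical
  induction s using Finset.induction_on with
  | empty => simp [hP.bot_notMem]
  | insert i s _ ih => simp [hP.sup_mem, ih]

/-- A finite family of prime filters can be prescribed on any upper set of indices. -/
theorem exists_forall_mem_iff {L ι : Type*} [Lattice L] [BoundedOrder L] [Fintype ι]
    {P : ι → L → Prop} (hP : ∀ i, IsPrimeFilter (P i)) (U : ι → Prop)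
    (hU : ∀ i j, (∀ a, P i a → P j a) → U i → U j) : ∃ a, ∀ i, P i a ↔ U i := by
  classical
  have h : ∀ i j, ∃ a, U i → ¬ U j → P i a ∧ ¬ P j a := by
    intro i j
    by_cases hij : U i ∧ ¬ U j
    · by_contra! hne
      exact hij.2 (hU i j (fun a ha => (hne a).2.2 ha) hij.1)
    · exact ⟨⊤, fun hi hj => absurd ⟨hi, hj⟩ hij⟩
  choose s hs using h
  -- `s i j` lies in `P i` but not in `P j`. For `i` in `U`, the meet over all `j` outside `U` lies
  -- in `P i` and in no such `P j`; the join collects these meets.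
  refine ⟨(Finset.univ.filter U).sup fun i => (Finset.univ.filter fun j => ¬ U j).inf (s i),
    fun i => ?_⟩
  simp only [(hP i).finset_sup_mem, (hP i).finset_inf_mem, Finset.mem_filter, Finset.mem_univ,
    true_and]
  constructor
  · rintro ⟨j, hj, hji⟩
    by_contra hi
    exact (hs j i hj hi).2 (hji i hi)
  · exact fun hi => ⟨i, hi, fun j hj => (hs i j hi hj).1⟩

theorem exists_mem_notMem {L : Type*} [DistribLattice L] [BoundedOrder L] {x y : L}
    (h : ¬ x ≤ y) : ∃ P : L → Prop, IsPrimeFilter P ∧ P x ∧ ¬ P y := by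
  have hdis : Disjoint (Order.PFilter.principal x : Set L) (Order.Ideal.principal y : Set L) := by
    rw [Set.disjoint_left]
    intro a ha hb
    exact h (le_trans (Order.PFilter.mem_principal.1 ha) (Order.Ideal.mem_principal.1 hb))
  obtain ⟨J, hJ, hyJ, hxJ⟩ := DistribLattice.prime_ideal_of_disjoint_filter_ideal hdis
  refine ⟨fun a => a ∉ J, ⟨?_, ?_, ?_, ?_⟩, ?_, ?_⟩
  · exact hJ.toIsProper.top_notMem
  · exact fun h => h J.bot_mem
  · intro a b
    constructor
    · exact fun hab => ⟨fun ha => hab (J.lower inf_le_left ha),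
        fun hb => hab (J.lower inf_le_right hb)⟩
    · rintro ⟨ha, hb⟩ hab
      exact (hJ.mem_or_mem hab).elim ha hb
  · intro a b
    rw [Order.Ideal.sup_mem_iff]
    tauto
  · exact Set.disjoint_left.1 hxJ (Order.PFilter.mem_principal.2 le_rfl)
  · exact fun hy => hy (hyJ (Order.Ideal.mem_principal.2 le_rfl))

theorem ext_of_forall {L : Type*} [DistribLattice L] [BoundedOrder L] {x y : L}
    (h : ∀ P : L → Prop, IsPrimeFilter P → (P x ↔ P y)) : x = y := by
  refine le_antisymm ?_ ?_ <;> by_contra hne <;>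
    obtain ⟨P, hP, h1, h2⟩ := exists_mem_notMem hne
  · exact h2 ((h P hP).1 h1)
  · exact h2 ((h P hP).2 h1)

end IsPrimeFilter

/-! ### Prime filters of mpM-algebras and the homomorphisms they define. -/

namespace MpMAlgebra

variable {A : Type*} [MpMAlgebra A]

theorem dm_inf (x y : A) : dm (x ⊓ y) = dm x ⊔ dm y := by
  rw [← dm_dm (dm x ⊔ dm y), dm_sup, dm_dm, dm_dm]

theorem dm_bot : dm (⊥ : A) = ⊤ := by
  have h : dm (⊥ ⊔ dm (⊤ : A)) = dm ⊥ ⊓ dm (dm ⊤) := dm_sup _ _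
  rw [bot_sup_eq, dm_dm, inf_top_eq] at h
  exact h.symm

theorem dm_top : dm (⊤ : A) = ⊥ := by rw [← dm_bot, dm_dm]

theorem inf_pc (x : A) : x ⊓ pc x = ⊥ := (inf_eq_bot_iff _ _).2 le_rfl

/-- The image `{a | ∼a ∉ P}` of a prime filter under the Birula-Rasiowa transformation. -/
def dual (P : A → Prop) : A → Prop := fun a => ¬ P (dm a)

theorem dual_dual (P : A → Prop) : dual (dual P) = P := by
  funext a
  simp [dual, dm_dm]

variable {P Q : A → Prop}

theorem isPrimeFilter_dual (hP : IsPrimeFilter P) : IsPrimeFilter (dual P) where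
  top_mem := by simpa [dual, dm_top] using hP.bot_notMem
  bot_notMem := by simpa [dual, dm_bot] using hP.top_mem
  inf_mem x y := by simp only [dual, dm_inf, hP.sup_mem]; tauto
  sup_mem x y := by simp only [dual, dm_sup, hP.inf_mem]; tauto

theorem dual_dm (a : A) : dual P (dm a) ↔ ¬ P a := by simp [dual, dm_dm]

theorem not_pc_of_mem (hP : IsPrimeFilter P) {a : A} (ha : P a) : ¬ P (pc a) := fun h =>
  hP.bot_notMem (by rw [← inf_pc a, hP.inf_mem]; exact ⟨ha, h⟩)

/-- Since `a ∉ dual P` means `∼a ∈ P`, the axiom `a ⊔ ∼a ≤ a ⊔ a*` puts `a ⊔ a*` into `P`.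
Everything below that depends on this axiom goes through this lemma. -/
theorem pc_mem (hP : IsPrimeFilter P) {a : A} (ha : ¬ P a) (ha' : ¬ dual P a) : P (pc a) := by
  have h : P (a ⊔ dm a) := (hP.sup_mem _ _).2 (Or.inr (not_not.1 ha'))
  exact ((hP.sup_mem _ _).1 (hP.mono (tm a) h)).resolve_left ha

theorem pc_mem_dual (hP : IsPrimeFilter P) {a : A} (ha : ¬ P a) (ha' : ¬ dual P a) :
    dual P (pc a) :=
  pc_mem (isPrimeFilter_dual hP) ha' (by rwa [dual_dual])

/-- If `a ∈ Q` were outside `dual P`, then `a ⊓ b` would lie in neither `P` nor `dual P`. By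
`pc_mem` its pseudocomplement would be in `P ⊆ Q`, although `a ⊓ b ∈ Q`. -/
theorem le_dual_of_lt (hP : IsPrimeFilter P) (hQ : IsPrimeFilter Q) (h : ∀ a, P a → Q a)
    {b : A} (hbQ : Q b) (hbP : ¬ P b) : ∀ a, Q a → dual P a := by
  intro a haQ
  have hab : ¬ P (a ⊓ b) := fun hab => hbP ((hP.inf_mem _ _).1 hab).2
  by_contra had
  have habd : ¬ dual P (a ⊓ b) := fun h =>
    had (((isPrimeFilter_dual hP).inf_mem _ _).1 h).1
  exact not_pc_of_mem hQ ((hQ.inf_mem _ _).2 ⟨haQ, hbQ⟩) (h _ (pc_mem hP hab habd))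

/-- A prime filter lies below no prime filters except itself and its dual. -/
theorem eq_or_eq_dual_of_le (hP : IsPrimeFilter P) (hQ : IsPrimeFilter Q)
    (h : ∀ a, P a → Q a) : Q = P ∨ Q = dual P := by
  by_cases hQP : ∀ a, Q a → P a
  · exact Or.inl (funext fun a => propext ⟨hQP a, h a⟩)
  right
  push Not at hQP
  obtain ⟨b, hbQ, hbP⟩ := hQP
  have hle := le_dual_of_lt hP hQ h hbQ hbP
  refine funext fun a => propext ⟨hle a, fun ha => ?_⟩
  by_contra haQ
  -- If `Q` were strictly below `dual P`, the same lemma would give `dual P ⊆ dual Q`. But `∼b` is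
  -- in `dual P` because `b ∉ P`, and not in `dual Q` because `b ∈ Q`.
  have h1 := le_dual_of_lt hQ (isPrimeFilter_dual hP) hle ha haQ
  refine h1 (dm b) ?_ (by rwa [dm_dm])
  exact (dual_dm b).2 hbP

/-- The four-element mpM-algebra whose De Morgan negation fixes both atoms. -/
instance instBoolProd : MpMAlgebra (Bool × Bool) where
  dm p := (!p.2, !p.1)
  pc p := (!p.1, !p.2)
  dm_dm := by decide
  dm_sup := by decide
  inf_eq_bot_iff := by decide
  tm := by decide

/-- The three-element chain as an mpM-algebra. -/
noncomputable instance instFinThree : MpMAlgebra (Fin 3) where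
  dm := Fin.rev
  pc x := if x = 0 then 2 else 0
  dm_dm := by decide
  dm_sup := by decide
  inf_eq_bot_iff := by decide
  tm := by decide

theorem isPrimeFilter_fst {f : A → Bool × Bool} (hf : IsMpMHom f) :
    IsPrimeFilter fun a => (f a).1 = true where
  top_mem := by rw [hf.map_top]; rfl
  bot_notMem := by rw [hf.map_bot]; decide
  inf_mem x y := by rw [hf.map_inf]; simp
  sup_mem x y := by rw [hf.map_sup]; simp

theorem isPrimeFilter_le {f : A → Fin 3} (hf : IsMpMHom f) {c : Fin 3} (hc : c ≠ 0) :
    IsPrimeFilter fun a => c ≤ f a where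
  top_mem := by rw [hf.map_top]; exact le_top
  bot_notMem := by rw [hf.map_bot, le_bot_iff]; exact hc
  inf_mem x y := by rw [hf.map_inf]; exact le_inf_iff
  sup_mem x y := by rw [hf.map_sup]; exact le_sup_iff

theorem dual_fst {f : A → Bool × Bool} (hf : IsMpMHom f) :
    dual (fun a => (f a).1 = true) = fun a => (f a).2 = true := by
  funext a
  simp [dual, hf.map_dm, dm]

theorem dual_two_le {f : A → Fin 3} (hf : IsMpMHom f) :
    dual (fun a => 2 ≤ f a) = fun a => 1 ≤ f a := by
  have h : ∀ x : Fin 3, ¬ 2 ≤ Fin.rev x ↔ 1 ≤ x := by decide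
  funext a
  rw [dual, hf.map_dm]
  exact propext (h (f a))

theorem dual_one_le {f : A → Fin 3} (hf : IsMpMHom f) :
    dual (fun a => 1 ≤ f a) = fun a => 2 ≤ f a := by
  rw [← dual_two_le hf, dual_dual]

open Classical in
/-- The map onto the four-element algebra determined by a prime filter and its dual. -/
noncomputable def toBoolProd (P : A → Prop) (a : A) : Bool × Bool :=
  (decide (P a), decide (dual P a))

open Classical in
/-- The map onto the three-element chain determined by a prime filter and its dual. -/
noncomputable def toFinThree (P : A → Prop) (a : A) : Fin 3 :=
  if P a then 2 else if dual P a then 1 else 0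

/-- The element `a ⊓ b` avoids both filters, so `pc_mem_dual` applies to it, and `(a ⊓ b)* ⊓ b ≤
a*`. This makes `*` the Boolean complement at a filter not contained in its dual. -/
theorem pc_mem_dual_of_mem (hP : IsPrimeFilter P) {a b : A} (ha : ¬ dual P a)
    (hb : dual P b) (hb' : ¬ P b) : dual P (pc a) := by
  have h1 : dual P (pc (a ⊓ b)) := pc_mem_dual hP
    (fun h => hb' ((hP.inf_mem _ _).1 h).2)
    (fun h => ha (((isPrimeFilter_dual hP).inf_mem _ _).1 h).1)
  have h2 : pc (a ⊓ b) ⊓ b ≤ pc a := by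
    rw [← inf_eq_bot_iff, inf_comm (pc (a ⊓ b)), ← inf_assoc, inf_pc]
  exact (isPrimeFilter_dual hP).mono h2 (((isPrimeFilter_dual hP).inf_mem _ _).2 ⟨h1, hb⟩)

/-- Prime filters that are equal to or incomparable with their dual yield homomorphisms to the
four-element algebra. -/
theorem isMpMHom_toBoolProd (hP : IsPrimeFilter P)
    (h : P = dual P ∨ ((∃ b, P b ∧ ¬ dual P b) ∧ ∃ b, dual P b ∧ ¬ P b)) :
    IsMpMHom (toBoolProd P) where
  map_bot := by simp [toBoolProd, hP.bot_notMem, (isPrimeFilter_dual hP).bot_notMem]; rfl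
  map_top := by simp [toBoolProd, hP.top_mem, (isPrimeFilter_dual hP).top_mem]; rfl
  map_inf x y := by
    refine Prod.ext (Bool.eq_iff_iff.2 ?_) (Bool.eq_iff_iff.2 ?_)
    · simpa [toBoolProd] using hP.inf_mem x y
    · simpa [toBoolProd] using (isPrimeFilter_dual hP).inf_mem x y
  map_sup x y := by
    refine Prod.ext (Bool.eq_iff_iff.2 ?_) (Bool.eq_iff_iff.2 ?_)
    · simpa [toBoolProd] using hP.sup_mem x y
    · simpa [toBoolProd] using (isPrimeFilter_dual hP).sup_mem x y
  map_dm x := by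
    refine Prod.ext (Bool.eq_iff_iff.2 ?_) (Bool.eq_iff_iff.2 ?_)
    · have h1 : P (dm x) ↔ ¬ dual P x := by simp [dual]
      simpa [toBoolProd, dm] using h1
    · simpa [toBoolProd, dm] using dual_dm x
  map_pc x := by
    -- In the four-element algebra `*` complements each coordinate separately. A self-dual filter
    -- gets this from `pc_mem`; an incomparable pair uses a witness for each of the two
    -- non-inclusions.
    have h1 : P (pc x) ↔ ¬ P x := by
      refine ⟨fun h hx => not_pc_of_mem hP hx h, fun hx => ?_⟩
      rcases h with h | ⟨⟨b, hb, hb'⟩, _⟩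
      · exact pc_mem hP hx (by rwa [← h])
      · have := pc_mem_dual_of_mem (isPrimeFilter_dual hP) (a := x) (b := b)
        rw [dual_dual] at this
        exact this hx hb hb'
    have h2 : dual P (pc x) ↔ ¬ dual P x := by
      refine ⟨fun h hx => not_pc_of_mem (isPrimeFilter_dual hP) hx h, fun hx => ?_⟩
      rcases h with h | ⟨_, b, hb, hb'⟩
      · exact pc_mem_dual hP (by rwa [h]) hx
      · exact pc_mem_dual_of_mem hP hx hb hb'
    refine Prod.ext (Bool.eq_iff_iff.2 ?_) (Bool.eq_iff_iff.2 ?_)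
    · simpa [toBoolProd, pc] using h1
    · simpa [toBoolProd, pc] using h2

/-- Prime filters below their dual yield homomorphisms to the three-element chain. -/
theorem isMpMHom_toFinThree (hP : IsPrimeFilter P) (h : ∀ a, P a → dual P a) :
    IsMpMHom (toFinThree P) where
  map_bot := by simp [toFinThree, hP.bot_notMem, (isPrimeFilter_dual hP).bot_notMem]; rfl
  map_top := by simp [toFinThree, hP.top_mem]; rfl
  map_inf x y := by
    have h1 := hP.inf_mem x y
    have h2 := (isPrimeFilter_dual hP).inf_mem x y
    have h3 := h x
    have h4 := h y
    unfold toFinThree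
    by_cases P x <;> by_cases P y <;> by_cases dual P x <;> by_cases dual P y <;>
      simp_all only [if_true, if_false, and_self, and_true, and_false, iff_true, iff_false,
        not_true] <;> rfl
  map_sup x y := by
    have h1 := hP.sup_mem x y
    have h2 := (isPrimeFilter_dual hP).sup_mem x y
    have h3 := h x
    have h4 := h y
    unfold toFinThree
    by_cases P x <;> by_cases P y <;> by_cases dual P x <;> by_cases dual P y <;>
      simp_all only [if_true, if_false, or_true, or_false, iff_true, iff_false] <;> rfl
  map_dm x := by
    have h1 : P (dm x) ↔ ¬ dual P x := by simp [dual]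
    have h2 := dual_dm (P := P) x
    have h3 := h x
    unfold toFinThree
    by_cases P x <;> by_cases dual P x <;>
      simp_all only [if_true, if_false, not_true, not_false_eq_true, iff_true, iff_false] <;> rfl
  map_pc x := by
    have h1 : dual P (pc x) ↔ ¬ dual P x := by
      refine ⟨fun h hx => not_pc_of_mem (isPrimeFilter_dual hP) hx h, fun hx => ?_⟩
      exact pc_mem_dual hP (fun hPx => hx (h _ hPx)) hx
    have h2 : P (pc x) ↔ ¬ dual P x :=
      ⟨fun hPx => h1.1 (h _ hPx), fun hx => pc_mem hP (fun hPx => hx (h _ hPx)) hx⟩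
    have h3 := h x
    unfold toFinThree
    by_cases P x <;> by_cases dual P x <;>
      simp_all only [if_true, if_false, not_true, not_false_eq_true, iff_true, iff_false] <;> rfl

theorem toBoolProd_fst (P : A → Prop) : (fun a => (toBoolProd P a).1 = true) = P := by
  funext a
  simp [toBoolProd]

theorem two_le_toFinThree (P : A → Prop) : (fun a => 2 ≤ toFinThree P a) = P := by
  funext a
  by_cases h1 : P a <;> by_cases h2 : dual P a <;> simp [toFinThree, h1, h2]

/-- Every prime filter comes from a homomorphism to the four-element algebra or from one to the
three-element chain that is not two-valued. -/
theorem exists_hom_of_isPrimeFilter (hP : IsPrimeFilter P) :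
    (∃ f : A → Bool × Bool, IsMpMHom f ∧ (fun a => (f a).1 = true) = P) ∨
    ∃ f : A → Fin 3, IsMpMHom f ∧ (∃ a, f a = 1) ∧
      ((fun a => 2 ≤ f a) = P ∨ (fun a => 1 ≤ f a) = P) := by
  by_cases h1 : ∀ a, P a → dual P a <;> by_cases h2 : ∀ a, dual P a → P a
  · exact Or.inl ⟨_, isMpMHom_toBoolProd hP
      (Or.inl (funext fun a => propext ⟨h1 a, h2 a⟩)), toBoolProd_fst P⟩
  · push Not at h2
    obtain ⟨a, ha, ha'⟩ := h2
    exact Or.inr ⟨_, isMpMHom_toFinThree hP h1, ⟨a, by simp [toFinThree, ha, ha']⟩,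
      Or.inl (two_le_toFinThree P)⟩
  · push Not at h1
    obtain ⟨a, ha, ha'⟩ := h1
    -- Here `dual P` is the smaller filter of the chain, so it takes level 2 and `P` becomes level
    -- 1.
    have hf := isMpMHom_toFinThree (isPrimeFilter_dual hP) (by rwa [dual_dual])
    refine Or.inr ⟨_, hf, ⟨a, by simp [toFinThree, ha, ha', dual_dual]⟩, Or.inr ?_⟩
    rw [← dual_two_le hf, two_le_toFinThree, dual_dual]
  · push Not at h1 h2
    exact Or.inl ⟨_, isMpMHom_toBoolProd hP (Or.inr ⟨h1, h2⟩), toBoolProd_fst P⟩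

end MpMAlgebra

/-! ### Representation as a product of copies of `Bool` and of the three-element chain. -/

namespace MpMAlgebra

variable {A : Type*} [MpMAlgebra A]

/-- Homomorphisms to the four-element algebra. -/
abbrev BoolProdHom (A : Type*) [MpMAlgebra A] : Type _ := {f : A → Bool × Bool // IsMpMHom f}

/-- Homomorphisms to the three-element chain that are not two-valued. -/
abbrev FinThreeHom (A : Type*) [MpMAlgebra A] : Type _ :=
  {f : A → Fin 3 // IsMpMHom f ∧ ∃ a, f a = 1}

/-- Since `*` complements both coordinates, an inclusion at `a*` is the reverse inclusion at `a`. -/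
theorem fst_eq_snd_of_comparable {f : A → Bool × Bool} (hf : IsMpMHom f)
    (h : (∀ a, (f a).1 = true → (f a).2 = true) ∨ ∀ a, (f a).2 = true → (f a).1 = true) (a : A) :
    (f a).1 = (f a).2 := by
  have key : ∀ p : Bool × Bool, (p.1 = true → p.2 = true) →
      ((pc p).1 = true → (pc p).2 = true) → p.1 = p.2 := by decide
  have key' : ∀ p : Bool × Bool, (p.2 = true → p.1 = true) →
      ((pc p).2 = true → (pc p).1 = true) → p.1 = p.2 := by decide
  have h2 := hf.map_pc a
  rcases h with h | h
  · exact key _ (h a) (h2 ▸ h (pc a))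
  · exact key' _ (h a) (h2 ▸ h (pc a))

/-- The filter of the second coordinate is the dual of that of the first, so one filter determines
the homomorphism. -/
theorem boolProd_hom_ext {f g : A → Bool × Bool} (hf : IsMpMHom f) (hg : IsMpMHom g)
    (h : (fun a => (f a).1 = true) = fun a => (g a).1 = true) : f = g := by
  have h' : (fun a => (f a).2 = true) = fun a => (g a).2 = true := by
    rw [← dual_fst hf, ← dual_fst hg, h]
  exact funext fun a => Prod.ext (Bool.eq_iff_iff.2 (congrFun h a).to_iff)
    (Bool.eq_iff_iff.2 (congrFun h' a).to_iff)

theorem finThree_hom_ext {f g : A → Fin 3} (hf : IsMpMHom f) (hg : IsMpMHom g)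
    (h : (fun a => 2 ≤ f a) = fun a => 2 ≤ g a) : f = g := by
  have h' : (fun a => 1 ≤ f a) = fun a => 1 ≤ g a := by
    rw [← dual_two_le hf, ← dual_two_le hg, h]
  have key : ∀ x y : Fin 3, (2 ≤ x ↔ 2 ≤ y) → (1 ≤ x ↔ 1 ≤ y) → x = y := by decide
  exact funext fun a => key _ _ (congrFun h a).to_iff (congrFun h' a).to_iff

/-- Taking duals, equality would place level 1 of `f` inside level 2 of `f`, against the value 1.
With the next two lemmas, the three kinds of filters are kept apart. -/
theorem two_le_ne_one_le {f g : A → Fin 3} (hf : IsMpMHom f) (hg : IsMpMHom g)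
    (h1 : ∃ a, f a = 1) : (fun a => 2 ≤ f a) ≠ fun a => 1 ≤ g a := by
  intro h
  have h' : (fun a => 1 ≤ f a) = fun a => 2 ≤ g a := by
    rw [← dual_two_le hf, ← dual_one_le hg, h]
  obtain ⟨a, ha⟩ := h1
  have h2 : 2 ≤ g a := (congrFun h' a).to_iff.1 ha.ge
  have h3 : 2 ≤ f a := (congrFun h a).to_iff.2 (le_trans (by decide) h2)
  rw [ha] at h3
  exact absurd h3 (by decide)

theorem fst_ne_two_le {f : A → Bool × Bool} {g : A → Fin 3} (hf : IsMpMHom f) (hg : IsMpMHom g)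
    (h1 : ∃ a, g a = 1) : (fun a => (f a).1 = true) ≠ fun a => 2 ≤ g a := by
  intro h
  have h' : (fun a => (f a).2 = true) = fun a => 1 ≤ g a := by
    rw [← dual_fst hf, ← dual_two_le hg, h]
  obtain ⟨a, ha⟩ := h1
  have h2 : (f a).1 = (f a).2 := fst_eq_snd_of_comparable hf (Or.inl fun b hb =>
    (congrFun h' b).to_iff.2 (le_trans (by decide) ((congrFun h b).to_iff.1 hb))) a
  have h3 : 2 ≤ g a := (congrFun h a).to_iff.1 (h2.trans ((congrFun h' a).to_iff.2 ha.ge))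
  rw [ha] at h3
  exact absurd h3 (by decide)

theorem fst_ne_one_le {f : A → Bool × Bool} {g : A → Fin 3} (hf : IsMpMHom f) (hg : IsMpMHom g)
    (h1 : ∃ a, g a = 1) : (fun a => (f a).1 = true) ≠ fun a => 1 ≤ g a := by
  intro h
  have h' : (fun a => (f a).2 = true) = fun a => 2 ≤ g a := by
    rw [← dual_fst hf, ← dual_one_le hg, h]
  obtain ⟨a, ha⟩ := h1
  have h2 : (f a).1 = (f a).2 := fst_eq_snd_of_comparable hf (Or.inr fun b hb =>
    (congrFun h b).to_iff.2 (le_trans (by decide) ((congrFun h' b).to_iff.1 hb))) a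
  have h3 : 2 ≤ g a := (congrFun h' a).to_iff.1 (h2.symm.trans ((congrFun h a).to_iff.2 ha.ge))
  rw [ha] at h3
  exact absurd h3 (by decide)

/-- The representation of an mpM-algebra by its simple quotients. -/
def repr (a : A) : (BoolProdHom A → Bool) × (FinThreeHom A → Fin 3) :=
  -- The first coordinate suffices: swapping coordinates is an automorphism of the four-element
  -- algebra, so the second coordinate of `f` is the first of another homomorphism.
  (fun f => (f.1 a).1, fun f => f.1 a)

theorem repr_injective : Function.Injective (repr (A := A)) := by
  intro x y h
  refine IsPrimeFilter.ext_of_forall fun P hP => ?_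
  rcases exists_hom_of_isPrimeFilter hP with ⟨f, hf, rfl⟩ | ⟨f, hf, h1, rfl | rfl⟩
  · have := congrFun (congrArg Prod.fst h) ⟨f, hf⟩
    simp only [repr] at this
    simp only [this]
  all_goals
    have := congrFun (congrArg Prod.snd h) ⟨f, hf, h1⟩
    simp only [repr] at this
    simp only [this]

theorem repr_surjective [Finite (BoolProdHom A)] [Finite (FinThreeHom A)] :
    Function.Surjective (repr (A := A)) := by
  rintro ⟨F, G⟩
  have := Fintype.ofFinite (BoolProdHom A)
  have := Fintype.ofFinite (FinThreeHom A)
  let P : BoolProdHom A ⊕ FinThreeHom A ⊕ FinThreeHom A → A → Prop :=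
    Sum.elim (fun f a => (f.1 a).1 = true)
      (Sum.elim (fun f a => 2 ≤ f.1 a) (fun f a => 1 ≤ f.1 a))
  let U : BoolProdHom A ⊕ FinThreeHom A ⊕ FinThreeHom A → Prop :=
    Sum.elim (fun f => F f = true) (Sum.elim (fun f => 2 ≤ G f) (fun f => 1 ≤ G f))
  have hP : ∀ i, IsPrimeFilter (P i) := by
    rintro (f | f | f)
    · exact isPrimeFilter_fst f.2
    · exact isPrimeFilter_le f.2.1 (by decide)
    · exact isPrimeFilter_le f.2.1 (by decide)
  -- Distinct indices carry distinct filters, and the only inclusions between them go from level 2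
  -- to level 1 of the same chain. There `2 ≤ G f` implies `1 ≤ G f`; all other cases are reflexive
  -- or impossible.
  have hU : ∀ i j, (∀ a, P i a → P j a) → U i → U j := by
    intro i j hij hi
    have hj := eq_or_eq_dual_of_le (hP i) (hP j) hij
    rcases i with f | f | f
    · have hj' : P j = fun a => (f.1 a).1 = true := by
        rcases hj with hj | hj
        · exact hj
        · have hd : P j = fun a => (f.1 a).2 = true := hj.trans (dual_fst f.2)
          have he := fst_eq_snd_of_comparable f.2 (Or.inl fun a ha => by
            have h := hij a ha
            rwa [hd] at h)
          simpa only [he] using hd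
      rcases j with g | g | g
      · rwa [Subtype.ext (boolProd_hom_ext g.2 f.2 hj')]
      · exact absurd hj'.symm (fst_ne_two_le f.2 g.2.1 g.2.2)
      · exact absurd hj'.symm (fst_ne_one_le f.2 g.2.1 g.2.2)
    · have hj' : P j = (fun a => 2 ≤ f.1 a) ∨ P j = fun a => 1 ≤ f.1 a :=
        hj.imp_right fun h => h.trans (dual_two_le f.2.1)
      rcases j with g | g | g
      · rcases hj' with h | h
        · exact absurd h (fst_ne_two_le g.2 f.2.1 f.2.2)
        · exact absurd h (fst_ne_one_le g.2 f.2.1 f.2.2)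
      · rcases hj' with h | h
        · rwa [Subtype.ext (finThree_hom_ext g.2.1 f.2.1 h)]
        · exact absurd h (two_le_ne_one_le g.2.1 f.2.1 g.2.2)
      · rcases hj' with h | h
        · exact absurd h.symm (two_le_ne_one_le f.2.1 g.2.1 f.2.2)
        · have h' : (fun a => 2 ≤ g.1 a) = fun a => 2 ≤ f.1 a := by
            rw [← dual_one_le g.2.1, ← dual_one_le f.2.1]
            exact congrArg dual h
          rw [Subtype.ext (finThree_hom_ext g.2.1 f.2.1 h')]
          exact le_trans (by decide : (1 : Fin 3) ≤ 2) hi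
    · have hj' : P j = fun a => 1 ≤ f.1 a := by
        rcases hj with hj | hj
        · exact hj
        · have hd : P j = fun a => 2 ≤ f.1 a := hj.trans (dual_one_le f.2.1)
          obtain ⟨a, ha⟩ := f.2.2
          have h := hij a ha.ge
          rw [hd, ha] at h
          exact absurd h (by decide)
      rcases j with g | g | g
      · exact absurd hj' (fst_ne_one_le g.2 f.2.1 f.2.2)
      · exact absurd hj' (two_le_ne_one_le g.2.1 f.2.1 g.2.2)
      · have h' : (fun a => 2 ≤ g.1 a) = fun a => 2 ≤ f.1 a := by
          rw [← dual_one_le g.2.1, ← dual_one_le f.2.1]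
          exact congrArg dual hj'
        rwa [Subtype.ext (finThree_hom_ext g.2.1 f.2.1 h')]
  obtain ⟨a, ha⟩ := IsPrimeFilter.exists_forall_mem_iff hP U hU
  have key : ∀ x y : Fin 3, (2 ≤ x ↔ 2 ≤ y) → (1 ≤ x ↔ 1 ≤ y) → x = y := by decide
  refine ⟨a, Prod.ext (funext fun f => ?_) (funext fun f => ?_)⟩
  · exact Bool.eq_iff_iff.2 (ha (Sum.inl f))
  · exact key _ _ (ha (Sum.inr (Sum.inl f))) (ha (Sum.inr (Sum.inr f)))

theorem finite_of_finite_hom [Finite (BoolProdHom A)] [Finite (FinThreeHom A)] : Finite A :=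
  Finite.of_injective repr repr_injective

theorem card_eq [Finite (BoolProdHom A)] [Finite (FinThreeHom A)] :
    Nat.card A = 2 ^ Nat.card (BoolProdHom A) * 3 ^ Nat.card (FinThreeHom A) := by
  rw [Nat.card_congr (Equiv.ofBijective _ ⟨repr_injective, repr_surjective⟩), Nat.card_prod,
    Nat.card_fun, Nat.card_fun]
  simp

/-- The two-element Boolean algebra as an mpM-algebra. -/
noncomputable instance instBool : MpMAlgebra Bool where
  dm p := !p
  pc p := !p
  dm_dm := by decide
  dm_sup := by decide
  inf_eq_bot_iff := by decide
  tm := by decide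

/-- The two-valued homomorphisms to the three-element chain. -/
def boolHomEquiv : {f : A → Bool // IsMpMHom f} ≃
    {f : {f : A → Fin 3 // IsMpMHom f} // ¬ ∃ a, f.1 a = 1} where
  toFun f := ⟨⟨fun a => bif f.1 a then 2 else 0, by
    constructor
    · rw [f.2.map_bot]; rfl
    · rw [f.2.map_top]; rfl
    · intro x y; rw [f.2.map_inf]; cases f.1 x <;> cases f.1 y <;> rfl
    · intro x y; rw [f.2.map_sup]; cases f.1 x <;> cases f.1 y <;> rfl
    · intro x; rw [f.2.map_dm]; cases f.1 x <;> rfl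
    · intro x; rw [f.2.map_pc]; cases f.1 x <;> rfl⟩, by
    rintro ⟨a, ha⟩
    have h2 : ∀ b : Bool, (bif b then (2 : Fin 3) else 0) ≠ 1 := by decide
    exact h2 (f.1 a) ha⟩
  invFun f := ⟨fun a => decide (f.1.1 a = 2), by
    have h1 : ∀ a, f.1.1 a = 0 ∨ f.1.1 a = 2 := by
      intro a
      have h2 : ∀ x : Fin 3, x ≠ 1 → x = 0 ∨ x = 2 := by decide
      exact h2 _ fun h => f.2 ⟨a, h⟩
    constructor
    · rw [f.1.2.map_bot]; rfl
    · rw [f.1.2.map_top]; rfl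
    · intro x y
      rw [f.1.2.map_inf]
      rcases h1 x with hx | hx <;> rcases h1 y with hy | hy <;> rw [hx, hy] <;> rfl
    · intro x y
      rw [f.1.2.map_sup]
      rcases h1 x with hx | hx <;> rcases h1 y with hy | hy <;> rw [hx, hy] <;> rfl
    · intro x
      rw [f.1.2.map_dm]
      rcases h1 x with hx | hx <;> rw [hx] <;> rfl
    · intro x
      rw [f.1.2.map_pc]
      rcases h1 x with hx | hx <;> rw [hx] <;> rfl⟩
  left_inv f := by
    refine Subtype.ext (funext fun a => ?_)
    change decide ((bif f.1 a then (2 : Fin 3) else 0) = 2) = f.1 a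
    cases f.1 a <;> rfl
  right_inv f := by
    refine Subtype.ext (Subtype.ext (funext fun a => ?_))
    have h2 : ∀ x : Fin 3, x ≠ 1 → (bif decide (x = 2) then 2 else 0) = x := by decide
    exact h2 _ fun h => f.2 ⟨a, h⟩

end MpMAlgebra

theorem IsMpMHom.comp {A B C : Type*} [MpMAlgebra A] [MpMAlgebra B] [MpMAlgebra C]
    {g : B → C} {f : A → B} (hg : IsMpMHom g) (hf : IsMpMHom f) : IsMpMHom (g ∘ f) where
  map_bot := by simp only [Function.comp_apply, hf.map_bot, hg.map_bot]
  map_top := by simp only [Function.comp_apply, hf.map_top, hg.map_top]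
  map_inf x y := by simp only [Function.comp_apply, hf.map_inf, hg.map_inf]
  map_sup x y := by simp only [Function.comp_apply, hf.map_sup, hg.map_sup]
  map_dm x := by simp only [Function.comp_apply, hf.map_dm, hg.map_dm]
  map_pc x := by simp only [Function.comp_apply, hf.map_pc, hg.map_pc]

/-! ### Homomorphisms out of the free algebra and their number. -/

section Free

variable {k : ℕ} {X : Type*}

instance instMpMAlgebraPi {ι B : Type*} [MpMAlgebra B] : MpMAlgebra (ι → B) where
  dm f i := MpMAlgebra.dm (f i)
  pc f i := MpMAlgebra.pc (f i)
  dm_dm f := funext fun i => MpMAlgebra.dm_dm (f i)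
  dm_sup f g := funext fun i => MpMAlgebra.dm_sup (f i) (g i)
  inf_eq_bot_iff f g := by
    simp only [funext_iff, Pi.le_def, ← MpMAlgebra.inf_eq_bot_iff, Pi.inf_apply, Pi.bot_apply]
  tm f i := MpMAlgebra.tm (f i)

theorem shift_iterate {B : Type*} (m : ℕ) (f : ZMod k → B) :
    (fun (f : ZMod k → B) (j : ZMod k) => f (j + 1))^[m] f = fun j => f (j + m) := by
  induction m generalizing f with
  | zero => simp
  | succ m ih =>
    rw [Function.iterate_succ_apply, ih]
    funext j
    push_cast
    rw [add_assoc]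

variable {B : Type*} [MpMAlgebra B]

/-- The cyclic shift makes the power of an mpM-algebra with exponent `ZMod k` a `C_k`-algebra. -/
instance instCkAlgebraPi : CkAlgebra k (ZMod k → B) where
  t f j := f (j + 1)
  t_hom := ⟨rfl, rfl, fun _ _ => rfl, fun _ _ => rfl, fun _ => rfl, fun _ => rfl⟩
  t_bijective := by
    refine Function.bijective_iff_has_inverse.2 ⟨fun f j => f (j - 1), fun f => ?_, fun f => ?_⟩
    · funext j; simp
    · funext j; simp
  t_iterate f := by rw [shift_iterate]; simp

namespace FreeCk

theorem isMpMHom_tMap_iterate [NeZero k] (m : ℕ) :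
    IsMpMHom (tMap^[m] : FreeCk k X → FreeCk k X) := by
  have ht : IsMpMHom (tMap : FreeCk k X → FreeCk k X) := CkAlgebra.t_hom (k := k)
  induction m with
  | zero => exact ⟨rfl, rfl, fun _ _ => rfl, fun _ _ => rfl, fun _ => rfl, fun _ => rfl⟩
  | succ m ih => exact ih.comp ht

theorem hom_ext [NeZero k] {f g : FreeCk k X → B} (hf : IsMpMHom f) (hg : IsMpMHom g)
    (h : ∀ i m, f (tMap^[m] (of i)) = g (tMap^[m] (of i))) : f = g := by
  -- The maps need not respect `t`, so the induction carries all iterates at once; a leading `t` in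
  -- the term only raises `m` by one.
  suffices H : ∀ (x : CkTerm X) m, f (tMap^[m] (mk x)) = g (tMap^[m] (mk x)) from
    funext (ind fun x => H x 0)
  have hf' := fun m => hf.comp (isMpMHom_tMap_iterate m)
  have hg' := fun m => hg.comp (isMpMHom_tMap_iterate m)
  intro x
  induction x with
  | var i => exact h i
  | bot => exact fun m => (hf' m).map_bot.trans (hg' m).map_bot.symm
  | top => exact fun m => (hf' m).map_top.trans (hg' m).map_top.symm
  | inf x y hx hy =>
    exact fun m => ((hf' m).map_inf (mk x) (mk y)).trans
      ((congrArg₂ _ (hx m) (hy m)).trans ((hg' m).map_inf (mk x) (mk y)).symm)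
  | sup x y hx hy =>
    exact fun m => ((hf' m).map_sup (mk x) (mk y)).trans
      ((congrArg₂ _ (hx m) (hy m)).trans ((hg' m).map_sup (mk x) (mk y)).symm)
  | dm x hx =>
    exact fun m => ((hf' m).map_dm (mk x)).trans
      ((congrArg _ (hx m)).trans ((hg' m).map_dm (mk x)).symm)
  | pc x hx =>
    exact fun m => ((hf' m).map_pc (mk x)).trans
      ((congrArg _ (hx m)).trans ((hg' m).map_pc (mk x)).symm)
  | t x hx => exact fun m => hx (m + 1)

/-- Extend `v` to a `C_k`-homomorphism into the shift algebra `ZMod k → B` and evaluate at 0;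
applying `t` `m` times moves the evaluation point to `m`. -/
theorem exists_hom [NeZero k] (v : X → ZMod k → B) :
    ∃ f : FreeCk k X → B, IsMpMHom f ∧ ∀ i (m : ℕ), f (tMap^[m] (of i)) = v i m := by
  obtain ⟨F, ⟨hF, hv⟩, -⟩ := existsUnique_lift (k := k) v
  refine ⟨fun a => F a 0, ⟨?_, ?_, ?_, ?_, ?_, ?_⟩, fun i m => ?_⟩
  · rw [hF.map_bot]; rfl
  · rw [hF.map_top]; rfl
  · intro x y; rw [hF.map_inf]; rfl
  · intro x y; rw [hF.map_sup]; rfl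
  · intro x; rw [hF.map_dm]; rfl
  · intro x; rw [hF.map_pc]; rfl
  · have h : ∀ (m : ℕ) (a : FreeCk k X) (j : ZMod k), F (tMap^[m] a) j = F a (j + m) := by
      intro m
      induction m with
      | zero => intro a j; simp
      | succ m ih =>
        intro a j
        have h1 : F (tMap (tMap^[m] a)) = CkAlgebra.t k (F (tMap^[m] a)) := hF.map_t _
        rw [Function.iterate_succ_apply', h1]
        change F (tMap^[m] a) (j + 1) = _
        rw [ih]
        push_cast
        rw [add_assoc, add_comm 1]
    simp only [h, hv, zero_add]

/-- The homomorphisms of mpM-algebras from the free `C_k`-algebra are determined by arbitrary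
values on the iterates of the generators under `t`. -/
noncomputable def homEquiv (k : ℕ) [NeZero k] (X B : Type*) [MpMAlgebra B] :
    {f : FreeCk k X → B // IsMpMHom f} ≃ (X → ZMod k → B) :=
  Equiv.ofBijective (fun f i j => f.1 (tMap^[j.val] (of i))) <| by
    constructor
    · intro f g h
      refine Subtype.ext (hom_ext f.2 g.2 fun i m => ?_)
      -- The values `j.val` reach only exponents below `k`; periodicity of `t` supplies the rest.
      have h1 : ∀ a : FreeCk k X, tMap^[m % k] a = tMap^[m] a := fun a =>
        Function.IsPeriodicPt.iterate_mod_apply (tMap_iterate a) m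
      have h2 := congrFun (congrFun h i) (m : ZMod k)
      simpa only [ZMod.val_natCast, h1] using h2
    · intro v
      obtain ⟨f, hf, hv⟩ := exists_hom v
      refine ⟨⟨f, hf⟩, funext fun i => funext fun j => ?_⟩
      simp [hv]

theorem card_hom (k n : ℕ) [NeZero k] (B : Type*) [MpMAlgebra B] :
    Nat.card {f : FreeCk k (Fin n) → B // IsMpMHom f} = (Nat.card B ^ k) ^ n := by
  rw [Nat.card_congr (homEquiv k (Fin n) B), Nat.card_fun, Nat.card_fun, Nat.card_zmod,
    Nat.card_fin]

instance finite_hom [NeZero k] [Finite X] [Finite B] :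
    Finite {f : FreeCk k X → B // IsMpMHom f} :=
  Finite.of_equiv _ (homEquiv k X B).symm

instance finite_finThreeHom [NeZero k] [Finite X] :
    Finite (MpMAlgebra.FinThreeHom (FreeCk k X)) :=
  Finite.of_injective (fun f => (⟨f.1, f.2.1⟩ : {f : FreeCk k X → Fin 3 // IsMpMHom f}))
    fun _ _ h => Subtype.ext (Subtype.mk.inj h)

theorem card_finThreeHom (k n : ℕ) [NeZero k] :
    Nat.card (MpMAlgebra.FinThreeHom (FreeCk k (Fin n))) + (2 ^ k) ^ n = (3 ^ k) ^ n := by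
  have h3 := card_hom k n (Fin 3)
  have h2 := card_hom k n Bool
  rw [Nat.card_fin] at h3
  rw [Nat.card_eq_fintype_card (α := Bool), Fintype.card_bool,
    Nat.card_congr MpMAlgebra.boolHomEquiv] at h2
  rw [← h3, ← h2, ← Nat.card_congr (Equiv.subtypeSubtypeEquivSubtypeInter _ _), ← Nat.card_sum]
  classical
  exact Nat.card_congr (Equiv.sumCompl _)

theorem card_boolProdHom (k n : ℕ) [NeZero k] :
    Nat.card (MpMAlgebra.BoolProdHom (FreeCk k (Fin n))) = (4 ^ k) ^ n := by
  rw [card_hom, Nat.card_eq_fintype_card]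
  rfl

end FreeCk

end Free

/-! ### Comparison of the two counts. -/

theorem mainTheorem3 (k n : ℕ) (hk : 0 < k) :
    Finite (FreeCk k (Fin n)) ∧
      (Nat.card (FreeCk k (Fin n)) : ℝ) =
        (∏ d ∈ k.divisors, ((2 : ℝ) ^ d) ^ (alpha2 n d : ℝ)) *
        (∏ d ∈ k.divisors, ((3 : ℝ) ^ d) ^ (alpha3 n d : ℝ)) *
        (∏ d ∈ k.divisors, ((4 : ℝ) ^ d) ^ (alpha4 n d : ℝ)) := by
  have : NeZero k := ⟨hk.ne'⟩
  refine ⟨MpMAlgebra.finite_of_finite_hom, ?_⟩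
  rw [MpMAlgebra.card_eq, FreeCk.card_boolProdHom,
    prod_rpow_mul_eq two_pos (sum_mul_alpha2 n hk),
    prod_rpow_mul_eq three_pos (sum_mul_alpha3 n hk),
    prod_rpow_mul_eq four_pos (sum_mul_alpha4 n hk)]
  have h3 : (Nat.card (MpMAlgebra.FinThreeHom (FreeCk k (Fin n))) : ℝ) =
      (3 ^ k) ^ n - (2 ^ k) ^ n := by
    rw [eq_sub_iff_add_eq]
    exact_mod_cast FreeCk.card_finThreeHom k n
  -- Merging the powers of 2 and 4 gives the exponent `2^(kn) + 2 * ((4^(kn) - 2^(kn)) / 2) =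
  -- 4^(kn)`, the number of homomorphisms into the four-element algebra.
  have h4 : (4 : ℝ) = (2 : ℝ) ^ (2 : ℝ) := by norm_num
  rw [h4, ← Real.rpow_mul two_pos.le, mul_right_comm, ← Real.rpow_add two_pos]
  push_cast
  rw [← h3, Real.rpow_natCast]
  congr 1
  rw [← Real.rpow_natCast]
  congr 1
  push_cast
  ring
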